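/- **Setting.** Let $(\boldsymbol x_i,y_i)\in\mathbb R^d\times\mathbb R$, $i\in[N]$, be data with $\boldsymbol x_i\ne\boldsymbol 0$ and $\|\boldsymbol x_i\|\le R$, and let $\ell:\mathbb R\times\mathbb R\to\mathbb R$ be such that each $\ell_i:=\ell(\cdot,y_i)$ is differentiable and $L_\ell$-Lipschitz with an $L_{\ell'}$-Lipschitz derivative $\ell_i'$. For $\theta=(u_1,\boldsymbol w_1,\dots,u_H,\boldsymbol w_H)$ with $u_k\in\mathbb R$, $\boldsymbol w_k\in\mathbb R^d$ (with the Euclidean norm), let $$L(\theta)=\sum_{i=1}^N \ell_i\Big(\sum_{k=1}^H u_k\max\{\boldsymbol w_k^\top\boldsymbol x_i,0\}\Big),\qquad \rho_i=\ell_i'\Big(\sum_{k=1}^H u_k\max\{\boldsymbol w_k^\top\boldsymbol x_i,0\}\Big).$$ The Clarke subdifferential $\partial_C L(\theta)$ is the convex hull of all limits of gradients $\nabla L(\theta^n)$ along sequences $\theta^n\to\theta$ of points of differentiability of $L$; $\theta$ is $\varepsilon$-Clarke stationary ($\varepsilon\ge0$) if $\operatorname{dist}(\boldsymbol 0,\partial_C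 L(\theta))\le\varepsilon$. The point $\theta$ satisfies the Span Qualification (SQ) if for every $k\in[H]$ $$\operatorname{span}\{\boldsymbol x_i:\boldsymbol w_k^\top\boldsymbol x_i=0,\ u_k\rho_i\ge0\}\cap\operatorname{span}\{\boldsymbol x_j:\boldsymbol w_k^\top\boldsymbol x_j=0,\ u_k\rho_j<0\}=\{\boldsymbol 0\}.$$ The rounding algorithm Rnd-C, with input $\theta$ and $\delta$, sets $R_0=\max_i\|\boldsymbol x_i\|$, keeps $\widehat u_k=u_k$, and lets $\widehat{\boldsymbol w}_k$ be the minimizer of $\|\boldsymbol z-\boldsymbol w_k\|^2$ over all $\boldsymbol z\in\mathbb R^d$ such that, for every $i\in[N]$: $\boldsymbol z^\top\boldsymbol x_i\ge 2R_0\delta$ if $\boldsymbol x_i^\top\boldsymbol w_k>R_0\delta$; $\boldsymbol z^\top\boldsymbol x_i\le-2R_0\delta$ if $\boldsymbol x_i^\top\boldsymbol w_k<-R_0\delta$; and $\boldsymbol z^\top\boldsymbol x_i=0$ if $|\boldsymbol x_i^\top\boldsymbol w_k|\le R_0\delta$. **Theorem (Robust Clarke test).** Let $\theta^*=(u_1^*,\boldsymbol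 w_1^*,\dots,u_H^*,\boldsymbol w_H^*)$ be an $\varepsilon$-Clarke stationary point of $L$ that satisfies SQ. Put $B=\|\theta^*\|$, $$C_\tau^{\mathrm{Clarke}}=\frac1{4R}\min\big\{|\boldsymbol x_i^\top\boldsymbol w_k^*|: i\in[N],\,k\in[H],\,\boldsymbol x_i^\top\boldsymbol w_k^*\ne0\big\}$$ (which is $+\infty$ if all $\boldsymbol x_i^\top\boldsymbol w_k^*$ vanish) and $$C_\mu^{\mathrm{Clarke}}=6\,N H^2B^2R^2L_{\ell'}+3\,NHR\,L_\ell .$$ Let $0<\delta\le C_\tau^{\mathrm{Clarke}}$ with $\delta<+\infty$, and let $\theta$ satisfy $\|\theta-\theta^*\|\le\delta$. Then the quadratic programs of Rnd-C have unique solutions, so that its output $\widehat\theta$ for the input $\theta$, $\delta$ is well defined, and if $\widehat\theta$ satisfies SQ, then $$\operatorname{dist}\big(\boldsymbol 0,\partial_C L(\widehat\theta)\big)\le\varepsilon+C_\mu^{\mathrm{Clarke}}\cdot\delta .$$ -/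

import Mathlib

open Filter Topology

noncomputable section

namespace ShallowReLU

/-- The Clarke subdifferential: the convex hull of all limits of gradients `∇ f (p n)` along
sequences `p n → a` of points of differentiability of `f`. -/
def clarkeSubdiff {E : Type*} [NormedAddCommGroup E] [InnerProductSpace ℝ E] [CompleteSpace E]
    (f : E → ℝ) (a : E) : Set E :=
  convexHull ℝ {s : E | ∃ p : ℕ → E, Tendsto p atTop (𝓝 a) ∧
    (∀ n, DifferentiableAt ℝ f (p n)) ∧ Tendsto (fun n => gradient f (p n)) atTop (𝓝 s)}

/-- `a` is an `ε`-Clarke stationary point of `f`: `dist (0, ∂_C f a) ≤ ε`. The distance to a set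
is extended-valued (`∞` for the empty set). -/
def IsClarkeStationary {E : Type*} [NormedAddCommGroup E] [InnerProductSpace ℝ E]
    [CompleteSpace E] (f : E → ℝ) (ε : ℝ) (a : E) : Prop :=
  Metric.infEDist 0 (clarkeSubdiff f a) ≤ ENNReal.ofReal ε

/-- Parameters `(u₁, w₁, …, u_H, w_H)` with `u_k ∈ ℝ` and `w_k ∈ ℝᵈ`, with the Euclidean norm. -/
abbrev Params (d H : ℕ) : Type :=
  PiLp 2 (fun _ : Fin H => WithLp 2 (ℝ × EuclideanSpace ℝ (Fin d)))

variable {d N H : ℕ}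

/-- The output weight `u_k`. -/
def outWeight (θ : Params d H) (k : Fin H) : ℝ := (θ k).fst

/-- The inner weight `w_k`. -/
def inWeight (θ : Params d H) (k : Fin H) : EuclideanSpace ℝ (Fin d) := (θ k).snd

/-- The network output `∑ₖ u_k · max {w_kᵀ z, 0}`. -/
def predict (θ : Params d H) (z : EuclideanSpace ℝ (Fin d)) : ℝ :=
  ∑ k, outWeight θ k * max (inner ℝ (inWeight θ k) z) 0

/-- The empirical loss `L(θ) = ∑ᵢ ℓ (∑ₖ u_k · max {w_kᵀ x_i, 0}, y_i)`. -/
def empLoss (ℓ : ℝ → ℝ → ℝ) (x : Fin N → EuclideanSpace ℝ (Fin d)) (y : Fin N → ℝ)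
    (θ : Params d H) : ℝ :=
  ∑ i, ℓ (predict θ (x i)) (y i)

/-- `ρ_i = ℓ_i' (∑ₖ u_k · max {w_kᵀ x_i, 0})`, where `ℓ_i = ℓ (·, y_i)`. -/
def rho (ℓ : ℝ → ℝ → ℝ) (x : Fin N → EuclideanSpace ℝ (Fin d)) (y : Fin N → ℝ)
    (θ : Params d H) (i : Fin N) : ℝ :=
  deriv (fun t => ℓ t (y i)) (predict θ (x i))

/-- The index set `I_k⁺`. -/
def posIdx (ℓ : ℝ → ℝ → ℝ) (x : Fin N → EuclideanSpace ℝ (Fin d)) (y : Fin N → ℝ)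
    (θ : Params d H) (k : Fin H) : Set (Fin N) :=
  {i | inner ℝ (inWeight θ k) (x i) = 0 ∧ 0 ≤ outWeight θ k * rho ℓ x y θ i}

/-- The index set `I_k⁻`. -/
def negIdx (ℓ : ℝ → ℝ → ℝ) (x : Fin N → EuclideanSpace ℝ (Fin d)) (y : Fin N → ℝ)
    (θ : Params d H) (k : Fin H) : Set (Fin N) :=
  {i | inner ℝ (inWeight θ k) (x i) = 0 ∧ outWeight θ k * rho ℓ x y θ i < 0}

/-- Span Qualification: for every hidden node `k`, the spans of the data points indexed by `I_k⁺`
and by `I_k⁻` intersect only in `0` (equivalently, when `1 ≤ H`, the union over `k` of these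
intersections is `{0}`). -/
def SQ (ℓ : ℝ → ℝ → ℝ) (x : Fin N → EuclideanSpace ℝ (Fin d)) (y : Fin N → ℝ)
    (θ : Params d H) : Prop :=
  ∀ k, Submodule.span ℝ (x '' posIdx ℓ x y θ k) ⊓ Submodule.span ℝ (x '' negIdx ℓ x y θ k) = ⊥

/-- The largest data norm `max_i ‖x_i‖`, as computed by the rounding algorithm. -/
def maxNorm (x : Fin N → EuclideanSpace ℝ (Fin d)) : ℝ := ⨆ i, ‖x i‖

/-- The feasible set of the quadratic program that rounds the inner weight `w` with radius `δ`. -/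
def rndFeasible (x : Fin N → EuclideanSpace ℝ (Fin d)) (δ : ℝ)
    (w : EuclideanSpace ℝ (Fin d)) : Set (EuclideanSpace ℝ (Fin d)) :=
  {z | (∀ i, maxNorm x * δ < inner ℝ (x i) w → 2 * maxNorm x * δ ≤ inner ℝ z (x i)) ∧
    (∀ i, inner ℝ (x i) w < -(maxNorm x * δ) → inner ℝ z (x i) ≤ -(2 * maxNorm x * δ)) ∧
    (∀ i, |inner ℝ (x i) w| ≤ maxNorm x * δ → inner ℝ z (x i) = 0)}

/-- `θ'` is an output of the rounding algorithm Rnd-C on the input `θ` with radius `δ`: the `u_k`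
are kept, and each new inner weight minimizes `‖z - w_k‖²` over the feasible set. -/
def IsRndC (x : Fin N → EuclideanSpace ℝ (Fin d)) (δ : ℝ) (θ θ' : Params d H) : Prop :=
  ∀ k, outWeight θ' k = outWeight θ k ∧
    inWeight θ' k ∈ rndFeasible x δ (inWeight θ k) ∧
    IsMinOn (fun z => ‖z - inWeight θ k‖ ^ 2) (rndFeasible x δ (inWeight θ k)) (inWeight θ' k)

/-- The separation constant `(1 / (4R)) · min {|x_iᵀ w_k| : x_iᵀ w_k ≠ 0}`, which is `+∞` when all
the `x_iᵀ w_k` vanish. -/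
def separationConst (x : Fin N → EuclideanSpace ℝ (Fin d)) (R : ℝ) (θ : Params d H) : EReal :=
  ⨅ (i : Fin N) (k : Fin H) (_ : inner ℝ (x i) (inWeight θ k) ≠ 0),
    ((1 / (4 * R) * |inner ℝ (x i) (inWeight θ k)| : ℝ) : EReal)

/-- The curvature constant, for the parameter norm `B`, the data bound `R`, the Lipschitz constants
`Lℓ` of the `ℓ_i` and `Lℓ'` of the `ℓ_i'`, `N` data points and `H` hidden nodes. -/
def curvatureConst (B R Lℓ Lℓ' : ℝ) (N H : ℕ) : ℝ :=
  6 * (N : ℝ) * (H : ℝ) ^ 2 * B ^ 2 * R ^ 2 * Lℓ' + 3 * (N : ℝ) * (H : ℝ) * R * Lℓ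

end ShallowReLU

end

/-! Away from kinks the gradient of the loss has a closed form, `slopeGrad`, in which each pair
(node, data point) enters through a ReLU slope. Call slopes admissible if they lie in `[0, 1]` and
are forced at active and inactive pairs. Two inclusions link these candidate gradients to `∂_C L`.

Upper (`clarkeSubdiff_empLoss_subset`): limits of gradients are candidates with admissible slopes,
by compactness of the slope cube, and the candidates form a convex set because `slopeGrad` is affine
in the slopes.

Lower (`slopeGrad_mem_clarkeSubdiff`): under SQ every candidate lies in `∂_C L`. By Hahn–Banach it
suffices that, for each `q`, some limit of gradients has at least as large an inner product with
`q`. SQ decouples the data points of the two signs of `u_k ρ_i`, so one perturbation of `w_k` can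
choose the best slope at all kinks at once (`exists_maximizing_direction`).

Rounding recovers the activation pattern of `θ*`, zeros included, and stays within `δ` of it in
every coordinate block, since `w_k*` is feasible and projecting onto a convex set brings a point no
farther from any point of that set. Hence the same slopes are admissible at `θ*` and at the output.
The upper inclusion at `θ*` and the lower one at the output reduce the claim to comparing
`slopeGrad` at two nearby points with equal slopes (`norm_slopeGrad_sub_le`). -/

namespace ShallowReLU

variable {d N H : ℕ}

/-! ### Projections onto convex sets -/

section Projection

variable {E : Type*} [NormedAddCommGroup E] [InnerProductSpace ℝ E] {K : Set E} {w z z' : E}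

lemma inner_le_zero_of_isMinOn (hK : Convex ℝ K) (hz : z ∈ K)
    (hmin : IsMinOn (fun v => ‖v - w‖ ^ 2) K z) : ∀ v ∈ K, inner ℝ (w - z) (v - z) ≤ 0 := by
  refine (norm_eq_iInf_iff_real_inner_le_zero hK hz).1 ?_
  have : Nonempty K := ⟨⟨z, hz⟩⟩
  refine le_antisymm (le_ciInf fun v => ?_)
    (ciInf_le (f := fun v : K => ‖w - v‖) ⟨0, ?_⟩ ⟨z, hz⟩)
  · have h := hmin v.2
    simp only [Set.mem_ofPred_eq] at h
    rw [norm_sub_rev w z, norm_sub_rev w]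
    exact (sq_le_sq₀ (norm_nonneg _) (norm_nonneg _)).1 h
  · rintro _ ⟨v, rfl⟩
    exact norm_nonneg _

/-- Adding the two variational inequalities, each tested at the other minimizer, gives `‖z - z'‖ ^ 2
≤ 0`. -/
lemma eq_of_isMinOn (hK : Convex ℝ K) (hz : z ∈ K) (hz' : z' ∈ K)
    (h : IsMinOn (fun v => ‖v - w‖ ^ 2) K z) (h' : IsMinOn (fun v => ‖v - w‖ ^ 2) K z') :
    z = z' := by
  have h1 := inner_le_zero_of_isMinOn hK hz h z' hz'
  have h2 := inner_le_zero_of_isMinOn hK hz' h' z hz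
  have h3 : inner ℝ (w - z) (z' - z) + inner ℝ (w - z') (z - z') = inner ℝ (z - z') (z - z') := by
    rw [← neg_sub z z', inner_neg_right, neg_add_eq_sub, ← inner_sub_left]
    congr 1
    abel
  have h4 : inner ℝ (z - z') (z - z') ≤ (0 : ℝ) := by linarith
  rw [real_inner_self_eq_norm_sq] at h4
  exact sub_eq_zero.1 (norm_eq_zero.1 (pow_eq_zero_iff two_ne_zero |>.1
    (le_antisymm h4 (sq_nonneg _))))

/-- The angle at the projection `z` between `w` and `v` is not acute, so the cross term in `‖(w - z)
+ (z - v)‖ ^ 2` is nonnegative. -/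
lemma norm_sub_le_of_isMinOn (hK : Convex ℝ K) (hz : z ∈ K)
    (h : IsMinOn (fun v => ‖v - w‖ ^ 2) K z) {v : E} (hv : v ∈ K) : ‖z - v‖ ≤ ‖w - v‖ := by
  have h1 := inner_le_zero_of_isMinOn hK hz h v hv
  have h2 : ‖w - v‖ ^ 2 = ‖w - z‖ ^ 2 + 2 * inner ℝ (w - z) (z - v) + ‖z - v‖ ^ 2 := by
    rw [← norm_add_sq_real]
    congr 2
    abel
  rw [← neg_sub v z, inner_neg_right, norm_neg, norm_sub_rev v z] at h2
  refine (sq_le_sq₀ (norm_nonneg _) (norm_nonneg _)).1 ?_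
  nlinarith [sq_nonneg ‖w - z‖]

lemma exists_isMinOn [CompleteSpace E] (hne : K.Nonempty) (hc : IsClosed K) (hK : Convex ℝ K)
    (w : E) : ∃ z ∈ K, IsMinOn (fun v => ‖v - w‖ ^ 2) K z := by
  obtain ⟨z, hz, hzw⟩ := exists_norm_eq_iInf_of_complete_convex hne hc.isComplete hK w
  refine ⟨z, hz, fun v hv => ?_⟩
  have h : (⨅ v : K, ‖w - v‖) ≤ ‖w - v‖ :=
    ciInf_le (f := fun v : K => ‖w - v‖) ⟨0, by rintro _ ⟨v, rfl⟩; exact norm_nonneg _⟩ ⟨v, hv⟩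
  simp only [Set.mem_ofPred_eq]
  rw [norm_sub_rev z, norm_sub_rev v, hzw]
  rw [← hzw] at h ⊢
  gcongr

end Projection

/-! ### The rounding algorithm -/

section Rounding

variable (x : Fin N → EuclideanSpace ℝ (Fin d)) (δ : ℝ) (w : EuclideanSpace ℝ (Fin d))

lemma rndFeasible_eq_iInter : rndFeasible x δ w =
    (⋂ i, ⋂ _ : maxNorm x * δ < inner ℝ (x i) w, {z | 2 * maxNorm x * δ ≤ inner ℝ (x i) z}) ∩
    ((⋂ i, ⋂ _ : inner ℝ (x i) w < -(maxNorm x * δ),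
      {z | inner ℝ (x i) z ≤ -(2 * maxNorm x * δ)}) ∩
    (⋂ i, ⋂ _ : |inner ℝ (x i) w| ≤ maxNorm x * δ, {z | inner ℝ (x i) z = 0})) := by
  ext z
  simp [rndFeasible, real_inner_comm]

lemma convex_rndFeasible : Convex ℝ (rndFeasible x δ w) := by
  have hlin : ∀ i, IsLinearMap ℝ fun z => (inner ℝ (x i) z : ℝ) := fun i =>
    ⟨fun a b => inner_add_right _ _ _, fun c a => inner_smul_right _ _ _⟩
  rw [rndFeasible_eq_iInter]
  exact (convex_iInter₂ fun i _ => convex_halfSpace_ge (hlin i) _).inter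
    ((convex_iInter₂ fun i _ => convex_halfSpace_le (hlin i) _).inter
      (convex_iInter₂ fun i _ => convex_hyperplane (hlin i) _))

lemma isClosed_rndFeasible : IsClosed (rndFeasible x δ w) := by
  rw [rndFeasible_eq_iInter]
  refine (isClosed_iInter fun i => isClosed_iInter fun _ => isClosed_le (by fun_prop) (by fun_prop)).inter
    ((isClosed_iInter fun i => isClosed_iInter fun _ => isClosed_le (by fun_prop) (by fun_prop)).inter
      (isClosed_iInter fun i => isClosed_iInter fun _ => isClosed_eq (by fun_prop) (by fun_prop)))

variable {x δ w}

lemma norm_le_maxNorm (i : Fin N) : ‖x i‖ ≤ maxNorm x :=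
  le_ciSup (f := fun i => ‖x i‖) (Set.finite_range _).bddAbove i

lemma maxNorm_le {R : ℝ} (hR : ∀ i, ‖x i‖ ≤ R) (i : Fin N) : maxNorm x ≤ R :=
  have : Nonempty (Fin N) := ⟨i⟩
  ciSup_le hR

/-- The parameters `θ` and `θ'` have the same activation pattern on the data, including zeros. -/
def SameSigns (x : Fin N → EuclideanSpace ℝ (Fin d)) (θ θ' : Params d H) : Prop :=
  ∀ k i, SignType.sign (inner ℝ (inWeight θ k) (x i) : ℝ) =
    SignType.sign (inner ℝ (inWeight θ' k) (x i) : ℝ)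

variable {R : ℝ} {w₀ z : EuclideanSpace ℝ (Fin d)}

/-- Moving `w₀` by `δ` changes each inner product by at most `maxNorm x * δ`, while the nonzero ones
have size at least four times that. The threshold `maxNorm x * δ` therefore detects the sign pattern
of `w₀` from `w`. -/
lemma rounding_trichotomy (hx0 : ∀ i, x i ≠ 0) (hxR : ∀ i, ‖x i‖ ≤ R) (hδ0 : 0 < δ)
    (hsep : ∀ i, inner ℝ (x i) w₀ ≠ (0 : ℝ) → 4 * R * δ ≤ |inner ℝ (x i) w₀|)
    (hw : ‖w - w₀‖ ≤ δ) (i : Fin N) :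
    0 < maxNorm x * δ ∧
    ((2 * maxNorm x * δ ≤ inner ℝ (x i) w₀ ∧ maxNorm x * δ < inner ℝ (x i) w) ∨
     (inner ℝ (x i) w₀ ≤ -(2 * maxNorm x * δ) ∧ inner ℝ (x i) w < -(maxNorm x * δ)) ∨
     (inner ℝ (x i) w₀ = (0 : ℝ) ∧ |inner ℝ (x i) w| ≤ maxNorm x * δ)) := by
  have hM : 0 < maxNorm x := (norm_pos_iff.2 (hx0 i)).trans_le (norm_le_maxNorm i)
  have hMδ := mul_pos hM hδ0
  have hMR : maxNorm x * δ ≤ R * δ := by gcongr; exact maxNorm_le hxR i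
  have hd : |inner ℝ (x i) w - inner ℝ (x i) w₀| ≤ maxNorm x * δ := by
    rw [← inner_sub_right]
    exact (abs_real_inner_le_norm _ _).trans
      (mul_le_mul (norm_le_maxNorm i) hw (norm_nonneg _) hM.le)
  refine ⟨hMδ, ?_⟩
  rw [abs_le] at hd
  rcases lt_trichotomy (inner ℝ (x i) w₀ : ℝ) 0 with h | h | h
  · have := hsep i h.ne
    rw [abs_of_neg h] at this
    exact Or.inr (Or.inl ⟨by linarith, by linarith [hd.2]⟩)
  · exact Or.inr (Or.inr ⟨h, abs_le.2 ⟨by linarith [hd.1], by linarith [hd.2]⟩⟩)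
  · have := hsep i h.ne'
    rw [abs_of_pos h] at this
    exact Or.inl ⟨by linarith, by linarith [hd.1]⟩

lemma mem_rndFeasible_of_near (hx0 : ∀ i, x i ≠ 0) (hxR : ∀ i, ‖x i‖ ≤ R) (hδ0 : 0 < δ)
    (hsep : ∀ i, inner ℝ (x i) w₀ ≠ (0 : ℝ) → 4 * R * δ ≤ |inner ℝ (x i) w₀|)
    (hw : ‖w - w₀‖ ≤ δ) : w₀ ∈ rndFeasible x δ w := by
  refine ⟨fun i hi => ?_, fun i hi => ?_, fun i hi => ?_⟩ <;>
  · rw [real_inner_comm]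
    obtain ⟨h0, ⟨h1, h2⟩ | ⟨h1, h2⟩ | ⟨h1, h2⟩⟩ := rounding_trichotomy hx0 hxR hδ0 hsep hw i <;>
    linarith [neg_abs_le (inner ℝ (x i) w : ℝ), le_abs_self (inner ℝ (x i) w : ℝ)]

lemma sign_inner_eq_of_mem_rndFeasible (hx0 : ∀ i, x i ≠ 0) (hxR : ∀ i, ‖x i‖ ≤ R) (hδ0 : 0 < δ)
    (hsep : ∀ i, inner ℝ (x i) w₀ ≠ (0 : ℝ) → 4 * R * δ ≤ |inner ℝ (x i) w₀|)
    (hw : ‖w - w₀‖ ≤ δ) (hz : z ∈ rndFeasible x δ w) (i : Fin N) :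
    SignType.sign (inner ℝ w₀ (x i) : ℝ) = SignType.sign (inner ℝ z (x i) : ℝ) := by
  rw [real_inner_comm (x i) w₀]
  obtain ⟨h0, ⟨h1, h2⟩ | ⟨h1, h2⟩ | ⟨h1, h2⟩⟩ := rounding_trichotomy hx0 hxR hδ0 hsep hw i
  · rw [sign_pos (by linarith), sign_pos (by linarith [hz.1 i h2])]
  · rw [sign_neg (by linarith), sign_neg (by linarith [hz.2.1 i h2])]
  · rw [h1, hz.2.2 i h2]

lemma existsUnique_isRndC {θ : Params d H}
    (hne : ∀ k, (rndFeasible x δ (inWeight θ k)).Nonempty) : ∃! θ', IsRndC x δ θ θ' := by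
  choose z hz hmin using fun k => exists_isMinOn (hne k) (isClosed_rndFeasible x δ _)
    (convex_rndFeasible x δ _) (inWeight θ k)
  refine ⟨WithLp.toLp 2 fun k => WithLp.toLp 2 (outWeight θ k, z k),
    fun k => ⟨rfl, hz k, hmin k⟩, fun θ' hθ' => ?_⟩
  ext k
  have h1 : (θ' k).fst = outWeight θ k := (hθ' k).1
  have h2 : (θ' k).snd = z k :=
    eq_of_isMinOn (convex_rndFeasible x δ _) (hθ' k).2.1 (hz k) (hθ' k).2.2 (hmin k)
  exact (WithLp.ofLp_injective 2).eq_iff.1 (Prod.ext h1 h2)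

end Rounding

/-! ### Candidate gradients -/

/-- The value that the gradient of the loss would have if the slope of the ReLU of node `k` at the
data point `x i` were `lam k i`. -/
noncomputable def slopeGrad (ℓ : ℝ → ℝ → ℝ) (x : Fin N → EuclideanSpace ℝ (Fin d)) (y : Fin N → ℝ)
    (θ : Params d H) (lam : Fin H → Fin N → ℝ) : Params d H :=
  WithLp.toLp 2 fun k => WithLp.toLp 2
    (∑ i, rho ℓ x y θ i * max (inner ℝ (inWeight θ k) (x i)) 0,
     ∑ i, (outWeight θ k * rho ℓ x y θ i * lam k i) • x i)

/-- The slopes `lam` are in `[0, 1]`, and are the derivatives of the ReLU at active and inactive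
pairs. -/
def IsSlope (x : Fin N → EuclideanSpace ℝ (Fin d)) (θ : Params d H)
    (lam : Fin H → Fin N → ℝ) : Prop :=
  ∀ k i, lam k i ∈ Set.Icc (0 : ℝ) 1 ∧ (0 < (inner ℝ (inWeight θ k) (x i) : ℝ) → lam k i = 1) ∧
    ((inner ℝ (inWeight θ k) (x i) : ℝ) < 0 → lam k i = 0)

/-- The derivative of the ReLU, with the value `1/2` at `0`. -/
noncomputable def reluSlope (a : ℝ) : ℝ := if 0 < a then 1 else if a < 0 then 0 else 1 / 2

lemma reluSlope_of_pos {a : ℝ} (h : 0 < a) : reluSlope a = 1 := by simp [reluSlope, h]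

lemma reluSlope_of_neg {a : ℝ} (h : a < 0) : reluSlope a = 0 := by
  simp [reluSlope, h, h.le]

lemma reluSlope_zero : reluSlope 0 = 1 / 2 := by simp [reluSlope]

lemma isSlope_reluSlope (x : Fin N → EuclideanSpace ℝ (Fin d)) (θ : Params d H) :
    IsSlope x θ fun k i => reluSlope (inner ℝ (inWeight θ k) (x i)) := by
  refine fun k i => ⟨?_, reluSlope_of_pos, reluSlope_of_neg⟩
  simp only [reluSlope]
  split_ifs <;> constructor <;> norm_num

variable {ℓ : ℝ → ℝ → ℝ} {x : Fin N → EuclideanSpace ℝ (Fin d)} {y : Fin N → ℝ}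

lemma inner_slopeGrad (θ : Params d H) (lam : Fin H → Fin N → ℝ) (v : Params d H) :
    inner ℝ (slopeGrad ℓ x y θ lam) v =
      ∑ k, ((∑ i, rho ℓ x y θ i * max (inner ℝ (inWeight θ k) (x i)) 0) * outWeight v k +
        ∑ i, outWeight θ k * rho ℓ x y θ i * lam k i * inner ℝ (inWeight v k) (x i)) := by
  rw [PiLp.inner_apply]
  refine Finset.sum_congr rfl fun k _ => ?_
  rw [WithLp.prod_inner_apply]
  congr 1
  · simp [slopeGrad, outWeight, mul_comm]
  · simp only [slopeGrad, inWeight, sum_inner, real_inner_smul_left]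
    exact Finset.sum_congr rfl fun i _ => by rw [real_inner_comm]; rfl

lemma slopeGrad_combo (θ : Params d H) (lam mu : Fin H → Fin N → ℝ) {a b : ℝ} (hab : a + b = 1) :
    a • slopeGrad ℓ x y θ lam + b • slopeGrad ℓ x y θ mu =
      slopeGrad ℓ x y θ fun k i => a * lam k i + b * mu k i := by
  refine ext_inner_right ℝ fun v => ?_
  rw [inner_add_left, real_inner_smul_left, real_inner_smul_left, inner_slopeGrad,
    inner_slopeGrad, inner_slopeGrad, Finset.mul_sum, Finset.mul_sum, ← Finset.sum_add_distrib]
  refine Finset.sum_congr rfl fun k _ => ?_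
  have h : ∑ i, outWeight θ k * rho ℓ x y θ i * (a * lam k i + b * mu k i) *
      inner ℝ (inWeight v k) (x i) =
      a * ∑ i, outWeight θ k * rho ℓ x y θ i * lam k i * inner ℝ (inWeight v k) (x i) +
      b * ∑ i, outWeight θ k * rho ℓ x y θ i * mu k i * inner ℝ (inWeight v k) (x i) := by
    rw [Finset.mul_sum, Finset.mul_sum, ← Finset.sum_add_distrib]
    exact Finset.sum_congr rfl fun i _ => by ring
  rw [h]
  linear_combination
    ((∑ i, rho ℓ x y θ i * max (inner ℝ (inWeight θ k) (x i)) 0) * outWeight v k) * hab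

/-! ### Continuity -/

@[fun_prop]
lemma continuous_outWeight (k : Fin H) : Continuous fun θ : Params d H => outWeight θ k := by
  unfold outWeight; fun_prop

@[fun_prop]
lemma continuous_inWeight (k : Fin H) : Continuous fun θ : Params d H => inWeight θ k := by
  unfold inWeight; fun_prop

@[fun_prop]
lemma continuous_predict (z : EuclideanSpace ℝ (Fin d)) :
    Continuous fun θ : Params d H => predict θ z := by
  unfold predict; fun_prop

lemma continuous_rho (hd : ∀ i, Continuous (deriv fun t => ℓ t (y i))) (i : Fin N) :
    Continuous fun θ : Params d H => rho ℓ x y θ i :=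
  (hd i).comp (continuous_predict _)

lemma continuous_slopeGrad (hd : ∀ i, Continuous (deriv fun t => ℓ t (y i))) :
    Continuous fun p : Params d H × (Fin H → Fin N → ℝ) => slopeGrad ℓ x y p.1 p.2 := by
  have h := fun i => (continuous_rho (H := H) (x := x) hd i).comp
    (continuous_fst (Y := Fin H → Fin N → ℝ))
  simp only [Function.comp_def] at h
  unfold slopeGrad
  fun_prop

/-! ### Differentiability and the gradient -/

/-- At the kink `a = 0`, positive homogeneity makes the function linear in `t` for `t ≥ 0` only,
hence the one-sided derivative. -/
lemma hasDerivWithinAt_relu_line (a b : ℝ) :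
    HasDerivWithinAt (fun t => max (a + t * b) 0)
      (if 0 < a then b else if a < 0 then 0 else max b 0) (Set.Ici 0) 0 := by
  have hlin : HasDerivAt (fun t => a + t * b) b 0 := by
    simpa using ((hasDerivAt_id (0 : ℝ)).mul_const b).const_add a
  have hc : ContinuousAt (fun t => a + t * b) 0 := hlin.continuousAt
  split_ifs with h1 h2
  · refine (hlin.congr_of_eventuallyEq ?_).hasDerivWithinAt
    filter_upwards [hc.eventually (lt_mem_nhds (show 0 < a + 0 * b by simpa using h1))] with t ht
    exact max_eq_left ht.le
  · refine ((hasDerivAt_const (0 : ℝ) (0 : ℝ)).congr_of_eventuallyEq ?_).hasDerivWithinAt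
    filter_upwards [hc.eventually (gt_mem_nhds (show a + 0 * b < 0 by simpa using h2))] with t ht
    exact max_eq_right ht.le
  · obtain rfl : a = 0 := by linarith
    have h : HasDerivAt (fun t => t * max b 0) (max b 0) 0 := by
      simpa using (hasDerivAt_id (0 : ℝ)).mul_const (max b 0)
    refine h.hasDerivWithinAt.congr (fun t ht => ?_) (by simp)
    rw [zero_add, mul_max_of_nonneg _ _ ht, mul_zero]

lemma outWeight_add_smul (θ v : Params d H) (t : ℝ) (k : Fin H) :
    outWeight (θ + t • v) k = outWeight θ k + t * outWeight v k := rfl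

lemma inWeight_add_smul (θ v : Params d H) (t : ℝ) (k : Fin H) :
    inWeight (θ + t • v) k = inWeight θ k + t • inWeight v k := rfl

lemma hasDerivWithinAt_empLoss_line (hdiff : ∀ i, Differentiable ℝ fun t => ℓ t (y i))
    (θ v : Params d H) :
    HasDerivWithinAt (fun t : ℝ => empLoss ℓ x y (θ + t • v))
      (∑ i, rho ℓ x y θ i * ∑ k, (outWeight v k * max (inner ℝ (inWeight θ k) (x i)) 0 +
        outWeight θ k * (if 0 < (inner ℝ (inWeight θ k) (x i) : ℝ) then
          inner ℝ (inWeight v k) (x i) else if (inner ℝ (inWeight θ k) (x i) : ℝ) < 0 then 0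
          else max (inner ℝ (inWeight v k) (x i)) 0))) (Set.Ici 0) 0 := by
  unfold empLoss
  refine HasDerivWithinAt.fun_sum fun i _ => ?_
  have hp : HasDerivWithinAt (fun t : ℝ => predict (θ + t • v) (x i))
      (∑ k, (outWeight v k * max (inner ℝ (inWeight θ k) (x i)) 0 +
        outWeight θ k * (if 0 < (inner ℝ (inWeight θ k) (x i) : ℝ) then
          inner ℝ (inWeight v k) (x i) else if (inner ℝ (inWeight θ k) (x i) : ℝ) < 0 then 0
          else max (inner ℝ (inWeight v k) (x i)) 0))) (Set.Ici 0) 0 := by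
    unfold predict
    refine HasDerivWithinAt.fun_sum fun k _ => ?_
    have h1 : HasDerivWithinAt (fun t : ℝ => outWeight θ k + t * outWeight v k) (outWeight v k)
        (Set.Ici 0) 0 := by
      simpa using (((hasDerivAt_id (0 : ℝ)).mul_const (outWeight v k)).const_add
        (outWeight θ k)).hasDerivWithinAt
    have h2 := h1.mul (hasDerivWithinAt_relu_line (inner ℝ (inWeight θ k) (x i))
      (inner ℝ (inWeight v k) (x i)))
    simp only [zero_mul, add_zero] at h2
    refine h2.congr (fun t _ => ?_) ?_ <;>
    simp [outWeight_add_smul, inWeight_add_smul, inner_add_left, real_inner_smul_left]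
  have hl : HasDerivAt (fun t => ℓ t (y i)) (rho ℓ x y θ i) (predict (θ + (0 : ℝ) • v) (x i)) := by
    rw [zero_smul, add_zero]
    exact (hdiff i _).hasDerivAt
  exact hl.comp_hasDerivWithinAt 0 hp

lemma hasDerivAt_line_of_differentiableAt {E : Type*} [NormedAddCommGroup E]
    [InnerProductSpace ℝ E] [CompleteSpace E] {f : E → ℝ} {a : E} (hf : DifferentiableAt ℝ f a)
    (v : E) : HasDerivAt (fun t : ℝ => f (a + t • v)) (inner ℝ (gradient f a) v) 0 := by
  have h1 : HasDerivAt (fun t : ℝ => a + t • v) v 0 := by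
    simpa using ((hasDerivAt_id (0 : ℝ)).smul_const v).const_add a
  have h2 : HasFDerivAt f (InnerProductSpace.toDual ℝ E (gradient f a)) (a + (0 : ℝ) • v) := by
    rw [zero_smul, add_zero]
    exact hf.hasGradientAt.hasFDerivAt
  exact h2.comp_hasDerivAt (0 : ℝ) h1

/-- The loss may be differentiable although some ReLU sits at its kink, when the kinks cancel.
Averaging the one-sided derivative along `v` with minus the one along `-v` turns each kink into
`(max b 0 - max (-b) 0) / 2 = b / 2`, whence the slope `1/2`. -/
lemma gradient_empLoss (hdiff : ∀ i, Differentiable ℝ fun t => ℓ t (y i)) {θ : Params d H}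
    (hθ : DifferentiableAt ℝ (empLoss ℓ x y) θ) :
    gradient (empLoss ℓ x y) θ =
      slopeGrad ℓ x y θ fun k i => reluSlope (inner ℝ (inWeight θ k) (x i)) := by
  refine ext_inner_right ℝ fun v => ?_
  have hline := fun v : Params d H => (hasDerivAt_line_of_differentiableAt hθ v).hasDerivWithinAt
    (s := Set.Ici 0)
  have huniq : UniqueDiffWithinAt ℝ (Set.Ici (0 : ℝ)) 0 :=
    uniqueDiffOn_Ici 0 0 Set.self_mem_Ici
  have hp := huniq.eq_deriv _ (hline v) (hasDerivWithinAt_empLoss_line hdiff θ v)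
  have hm := huniq.eq_deriv _ (hline (-v)) (hasDerivWithinAt_empLoss_line hdiff θ (-v))
  rw [inner_neg_right] at hm
  have key : (inner ℝ (gradient (empLoss ℓ x y) θ) v : ℝ) =
      (inner ℝ (gradient (empLoss ℓ x y) θ) v - -inner ℝ (gradient (empLoss ℓ x y) θ) v) / 2 := by
    ring
  have swap : (inner ℝ (slopeGrad ℓ x y θ fun k i =>
      reluSlope (inner ℝ (inWeight θ k) (x i))) v : ℝ) =
      ∑ i, rho ℓ x y θ i * ∑ k, (outWeight v k * max (inner ℝ (inWeight θ k) (x i)) 0 +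
        outWeight θ k * (reluSlope (inner ℝ (inWeight θ k) (x i)) *
          inner ℝ (inWeight v k) (x i))) := by
    simp only [inner_slopeGrad, Finset.sum_mul, ← Finset.sum_add_distrib, Finset.mul_sum]
    rw [Finset.sum_comm]
    exact Finset.sum_congr rfl fun i _ => Finset.sum_congr rfl fun k _ => by ring
  rw [swap, key, hm, hp, ← Finset.sum_sub_distrib, Finset.sum_div]
  refine Finset.sum_congr rfl fun i _ => ?_
  rw [← mul_sub, mul_div_assoc, ← Finset.sum_sub_distrib, Finset.sum_div]
  congr 1
  refine Finset.sum_congr rfl fun k _ => ?_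
  have ho : outWeight (-v) k = -outWeight v k := rfl
  have hi : inWeight (-v) k = -inWeight v k := rfl
  rw [ho, hi, inner_neg_left]
  rcases lt_trichotomy (inner ℝ (inWeight θ k) (x i) : ℝ) 0 with h | h | h
  · rw [reluSlope_of_neg h, if_neg h.not_gt, if_neg h.not_gt, if_pos h, if_pos h]
    ring
  · rw [h, reluSlope_zero]
    simp only [lt_irrefl, if_false]
    have : ∀ b : ℝ, max b 0 - max (-b) 0 = b := fun b => by
      rcases le_total b 0 with hb | hb
      · rw [max_eq_right hb, max_eq_left (by linarith)]; ring
      · rw [max_eq_left hb, max_eq_right (by linarith)]; ring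
    linear_combination outWeight θ k / 2 * this (inner ℝ (inWeight v k) (x i))
  · rw [reluSlope_of_pos h, if_pos h, if_pos h]
    ring

lemma differentiableAt_relu {E : Type*} [NormedAddCommGroup E] [NormedSpace ℝ E] {f : E → ℝ}
    {a : E} (hf : DifferentiableAt ℝ f a) (h0 : f a ≠ 0) :
    DifferentiableAt ℝ (fun b => max (f b) 0) a := by
  rcases h0.lt_or_gt with h | h
  · refine (differentiableAt_const (0 : ℝ)).congr_of_eventuallyEq ?_
    filter_upwards [hf.continuousAt.eventually (gt_mem_nhds h)] with b hb
    exact max_eq_right hb.le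
  · refine hf.congr_of_eventuallyEq ?_
    filter_upwards [hf.continuousAt.eventually (lt_mem_nhds h)] with b hb
    exact max_eq_left hb.le

lemma differentiable_outWeight (k : Fin H) :
    Differentiable ℝ fun θ : Params d H => outWeight θ k :=
  ((ContinuousLinearMap.fst ℝ ℝ (EuclideanSpace ℝ (Fin d))).comp
    ((WithLp.prodContinuousLinearEquiv 2 ℝ ℝ (EuclideanSpace ℝ (Fin d))).toContinuousLinearMap.comp
      (PiLp.proj 2 (fun _ : Fin H => WithLp 2 (ℝ × EuclideanSpace ℝ (Fin d))) k))).differentiable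

lemma differentiable_inWeight (k : Fin H) :
    Differentiable ℝ fun θ : Params d H => inWeight θ k :=
  ((ContinuousLinearMap.snd ℝ ℝ (EuclideanSpace ℝ (Fin d))).comp
    ((WithLp.prodContinuousLinearEquiv 2 ℝ ℝ (EuclideanSpace ℝ (Fin d))).toContinuousLinearMap.comp
      (PiLp.proj 2 (fun _ : Fin H => WithLp 2 (ℝ × EuclideanSpace ℝ (Fin d))) k))).differentiable

lemma differentiableAt_empLoss (hdiff : ∀ i, Differentiable ℝ fun t => ℓ t (y i)) {θ : Params d H}
    (hθ : ∀ k i, inner ℝ (inWeight θ k) (x i) ≠ (0 : ℝ)) :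
    DifferentiableAt ℝ (empLoss ℓ x y) θ := by
  unfold empLoss
  refine DifferentiableAt.fun_sum fun i _ => ?_
  have hp : DifferentiableAt ℝ (fun θ : Params d H => predict θ (x i)) θ := by
    unfold predict
    refine DifferentiableAt.fun_sum fun k _ => ?_
    exact (differentiable_outWeight k θ).mul (differentiableAt_relu
      ((differentiable_inWeight k θ).inner ℝ (differentiableAt_const (x i))) (hθ k i))
  exact (hdiff i (predict θ (x i))).comp θ hp

/-! ### The upper inclusion for the Clarke subdifferential -/

lemma isSlope_of_tendsto {p : ℕ → Params d H} {θ : Params d H} (hp : Tendsto p atTop (𝓝 θ))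
    {lam : ℕ → Fin H → Fin N → ℝ} {mu : Fin H → Fin N → ℝ} (hlam : Tendsto lam atTop (𝓝 mu))
    (h : ∀ n, IsSlope x (p n) (lam n)) : IsSlope x θ mu := by
  intro k i
  have hl : Tendsto (fun n => lam n k i) atTop (𝓝 (mu k i)) :=
    (tendsto_pi_nhds.1 (tendsto_pi_nhds.1 hlam k)) i
  have hi : Tendsto (fun n => (inner ℝ (inWeight (p n) k) (x i) : ℝ)) atTop
      (𝓝 (inner ℝ (inWeight θ k) (x i))) :=
    (((continuous_inWeight k).inner continuous_const).tendsto θ).comp hp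
  refine ⟨isClosed_Icc.mem_of_tendsto hl (Eventually.of_forall fun n => (h n k i).1),
    fun h0 => ?_, fun h0 => ?_⟩
  · refine tendsto_nhds_unique hl (tendsto_const_nhds.congr' ?_)
    filter_upwards [hi.eventually (lt_mem_nhds h0)] with n hn
    exact ((h n k i).2.1 hn).symm
  · refine tendsto_nhds_unique hl (tendsto_const_nhds.congr' ?_)
    filter_upwards [hi.eventually (gt_mem_nhds h0)] with n hn
    exact ((h n k i).2.2 hn).symm

lemma clarkeSubdiff_empLoss_subset (hdiff : ∀ i, Differentiable ℝ fun t => ℓ t (y i))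
    (hd : ∀ i, Continuous (deriv fun t => ℓ t (y i))) (θ : Params d H) :
    clarkeSubdiff (empLoss ℓ x y) θ ⊆ {g | ∃ lam, IsSlope x θ lam ∧ slopeGrad ℓ x y θ lam = g} := by
  refine convexHull_min ?_ ?_
  · rintro s ⟨p, hp, hpd, hps⟩
    set lam : ℕ → Fin H → Fin N → ℝ :=
      fun n k i => reluSlope (inner ℝ (inWeight (p n) k) (x i)) with hlam
    have hs : ∀ n, IsSlope x (p n) (lam n) := fun n => isSlope_reluSlope x (p n)
    have hcpt : IsCompact (Set.univ.pi fun _ : Fin H => Set.univ.pi fun _ : Fin N =>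
        Set.Icc (0 : ℝ) 1) := isCompact_univ_pi fun _ => isCompact_univ_pi fun _ => isCompact_Icc
    -- The slopes along the sequence need not converge; a subsequence suffices because the limit of
    -- the gradients is already known to exist.
    obtain ⟨mu, -, φ, hφ, hmu⟩ := hcpt.tendsto_subseq (x := lam)
      fun n k _ i _ => (hs n k i).1
    have hpφ := hp.comp hφ.tendsto_atTop
    refine ⟨mu, isSlope_of_tendsto hpφ hmu fun n => hs (φ n), ?_⟩
    refine tendsto_nhds_unique
      (((continuous_slopeGrad hd).tendsto (θ, mu)).comp (hpφ.prodMk_nhds hmu))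
      ((hps.comp hφ.tendsto_atTop).congr fun n => ?_)
    exact gradient_empLoss hdiff (hpd (φ n))
  · rintro _ ⟨lam, hlam, rfl⟩ _ ⟨mu, hmu, rfl⟩ a b ha hb hab
    refine ⟨_, fun k i => ⟨?_, fun h => ?_, fun h => ?_⟩, (slopeGrad_combo θ lam mu hab).symm⟩
    · exact convex_Icc 0 1 (hlam k i).1 (hmu k i).1 ha hb hab
    · rw [(hlam k i).2.1 h, (hmu k i).2.1 h]; linarith
    · rw [(hlam k i).2.2 h, (hmu k i).2.2 h]; ring

/-! ### Generic directions -/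

/-- Since `U ⊓ W = ⊥`, the orthogonal complements span the whole space. Writing `q = a + b` with `a
∈ Uᗮ` and `b ∈ Wᗮ`, the vector `b - a` acts as `q` on `U` and as `-q` on `W`. This is how SQ enters.
-/
lemma exists_inner_eq_and_inner_eq_neg {E : Type*} [NormedAddCommGroup E] [InnerProductSpace ℝ E]
    [FiniteDimensional ℝ E] {U W : Submodule ℝ E} (h : U ⊓ W = ⊥) (q : E) :
    ∃ p : E, (∀ u ∈ U, inner ℝ p u = (inner ℝ q u : ℝ)) ∧
      ∀ w ∈ W, inner ℝ p w = -(inner ℝ q w : ℝ) := by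
  have htop : Uᗮ ⊔ Wᗮ = ⊤ := by
    rw [← Submodule.orthogonal_eq_bot_iff, ← Submodule.inf_orthogonal,
      Submodule.orthogonal_orthogonal, Submodule.orthogonal_orthogonal, h]
  obtain ⟨a, ha, b, hb, rfl⟩ := Submodule.mem_sup.1 (htop ▸ Submodule.mem_top : q ∈ Uᗮ ⊔ Wᗮ)
  refine ⟨b - a, fun u hu => ?_, fun w hw => ?_⟩
  · have := (Submodule.mem_orthogonal' U a).1 ha u hu
    rw [inner_sub_left, inner_add_left, this]
    ring
  · have := (Submodule.mem_orthogonal' W b).1 hb w hw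
    rw [inner_sub_left, inner_add_left, this]
    ring

lemma eventually_sign_add_mul (a b : ℝ) :
    ∀ᶠ t in 𝓝[>] (0 : ℝ), SignType.sign (a + t * b) = SignType.sign (if a = 0 then b else a) := by
  by_cases ha : a = 0
  · filter_upwards [self_mem_nhdsWithin] with t ht
    rw [if_pos ha, ha, zero_add, sign_mul, sign_pos ht, one_mul]
  · rw [if_neg ha]
    have hc : Tendsto (fun t : ℝ => a + t * b) (𝓝[>] 0) (𝓝 a) := by
      have : Continuous fun t : ℝ => a + t * b := by fun_prop
      simpa using (this.tendsto 0).mono_left nhdsWithin_le_nhds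
    rcases lt_or_gt_of_ne ha with h | h
    · filter_upwards [hc.eventually (gt_mem_nhds h)] with t ht
      rw [sign_neg ht, sign_neg h]
    · filter_upwards [hc.eventually (lt_mem_nhds h)] with t ht
      rw [sign_pos ht, sign_pos h]

/-- Finitely many hyperplanes do not cover the space, so some `g` avoids them all; adding a small
multiple of `g` to `p` breaks the ties and keeps the nonzero signs. -/
lemma exists_generic_direction (hx0 : ∀ i, x i ≠ 0) (p : EuclideanSpace ℝ (Fin d)) :
    ∃ v : EuclideanSpace ℝ (Fin d), (∀ i, inner ℝ v (x i) ≠ (0 : ℝ)) ∧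
      ∀ i, inner ℝ p (x i) ≠ (0 : ℝ) →
        SignType.sign (inner ℝ v (x i) : ℝ) = SignType.sign (inner ℝ p (x i) : ℝ) := by
  obtain ⟨g, hg⟩ := Module.Dual.exists_forall_ne_zero_of_forall_exists
    (fun i => (innerₛₗ ℝ (x i) : Module.Dual ℝ (EuclideanSpace ℝ (Fin d))))
    fun i => ⟨x i, by simpa using hx0 i⟩
  obtain ⟨t, ht⟩ := (eventually_all.2 fun i =>
    eventually_sign_add_mul (inner ℝ p (x i)) (inner ℝ g (x i))).exists
  have hin : ∀ i, inner ℝ (p + t • g) (x i) = (inner ℝ p (x i) + t * inner ℝ g (x i) : ℝ) :=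
    fun i => by rw [inner_add_left, real_inner_smul_left]
  have hg' : ∀ i, inner ℝ g (x i) ≠ (0 : ℝ) := fun i => by
    rw [real_inner_comm]; exact hg i
  refine ⟨p + t • g, fun i h0 => ?_, fun i hi => ?_⟩
  · have := ht i
    rw [← hin, h0, sign_zero, eq_comm, sign_eq_zero_iff] at this
    split_ifs at this with hp
    · exact hg' i this
    · exact hp this
  · rw [hin, ht i, if_neg hi]

/-! ### The lower inclusion for the Clarke subdifferential -/

lemma reluSlope_congr {a b : ℝ} (h : SignType.sign a = SignType.sign b) :
    reluSlope a = reluSlope b := by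
  rcases lt_trichotomy a 0 with ha | ha | ha
  · rw [sign_neg ha, eq_comm, sign_eq_neg_one_iff] at h
    rw [reluSlope_of_neg ha, reluSlope_of_neg h]
  · rw [ha, sign_zero, eq_comm, sign_eq_zero_iff] at h
    rw [ha, h]
  · rw [sign_pos ha, eq_comm, sign_eq_one_iff] at h
    rw [reluSlope_of_pos ha, reluSlope_of_pos h]

/-- The slopes at `θ` that are seen after an infinitesimal move of the inner weights along `v`. -/
noncomputable def dirSlope (x : Fin N → EuclideanSpace ℝ (Fin d)) (θ : Params d H)
    (v : Fin H → EuclideanSpace ℝ (Fin d)) (k : Fin H) (i : Fin N) : ℝ :=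
  reluSlope (if (inner ℝ (inWeight θ k) (x i) : ℝ) = 0 then inner ℝ (v k) (x i)
    else inner ℝ (inWeight θ k) (x i))

lemma exists_tendsto_gradient_of_eventually {E : Type*} [NormedAddCommGroup E]
    [InnerProductSpace ℝ E] [CompleteSpace E] {f : E → ℝ} {G : E → E} {a v : E}
    (hG : ContinuousAt G a)
    (h : ∀ᶠ t in 𝓝[>] (0 : ℝ), DifferentiableAt ℝ f (a + t • v) ∧
      gradient f (a + t • v) = G (a + t • v)) :
    ∃ p : ℕ → E, Tendsto p atTop (𝓝 a) ∧ (∀ n, DifferentiableAt ℝ f (p n)) ∧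
      Tendsto (fun n => gradient f (p n)) atTop (𝓝 (G a)) := by
  obtain ⟨t, ht, hts⟩ := exists_seq_forall_of_frequently h.frequently
  have hp : Tendsto (fun n => a + t n • v) atTop (𝓝 a) := by
    simpa using ((ht.mono_right nhdsWithin_le_nhds).smul_const v).const_add a
  exact ⟨_, hp, fun n => (hts n).1, (hG.tendsto.comp hp).congr fun n => (hts n).2.symm⟩

lemma differentiableAt_and_gradient_of_sign_eq (hdiff : ∀ i, Differentiable ℝ fun t => ℓ t (y i))
    {θ θ' : Params d H} {v : Fin H → EuclideanSpace ℝ (Fin d)}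
    (hv : ∀ k i, inner ℝ (v k) (x i) ≠ (0 : ℝ))
    (h : ∀ k i, SignType.sign (inner ℝ (inWeight θ' k) (x i) : ℝ) =
      SignType.sign (if (inner ℝ (inWeight θ k) (x i) : ℝ) = 0 then inner ℝ (v k) (x i)
        else inner ℝ (inWeight θ k) (x i) : ℝ)) :
    DifferentiableAt ℝ (empLoss ℓ x y) θ' ∧
      gradient (empLoss ℓ x y) θ' = slopeGrad ℓ x y θ' (dirSlope x θ v) := by
  have hd : DifferentiableAt ℝ (empLoss ℓ x y) θ' := by
    refine differentiableAt_empLoss hdiff fun k i h0 => ?_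
    have := h k i
    rw [h0, sign_zero, eq_comm, sign_eq_zero_iff] at this
    split_ifs at this with hz
    · exact hv k i this
    · exact hz this
  refine ⟨hd, ?_⟩
  rw [gradient_empLoss hdiff hd]
  congr 1
  funext k i
  exact reluSlope_congr (h k i)

/-- Just past `θ` on the ray along `v`, no pre-activation vanishes and the signs are constant, so
the gradient is `slopeGrad` with fixed slopes and converges by continuity. -/
lemma exists_tendsto_gradient_dirSlope (hdiff : ∀ i, Differentiable ℝ fun t => ℓ t (y i))
    (hd : ∀ i, Continuous (deriv fun t => ℓ t (y i))) (θ : Params d H)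
    {v : Fin H → EuclideanSpace ℝ (Fin d)} (hv : ∀ k i, inner ℝ (v k) (x i) ≠ (0 : ℝ)) :
    ∃ p : ℕ → Params d H, Tendsto p atTop (𝓝 θ) ∧
      (∀ n, DifferentiableAt ℝ (empLoss ℓ x y) (p n)) ∧
      Tendsto (fun n => gradient (empLoss ℓ x y) (p n)) atTop
        (𝓝 (slopeGrad ℓ x y θ (dirSlope x θ v))) := by
  obtain ⟨V, hV⟩ : ∃ V : Params d H, ∀ k, inWeight V k = v k :=
    ⟨WithLp.toLp 2 fun k => WithLp.toLp 2 (0, v k), fun _ => rfl⟩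
  have hc : Continuous fun θ' : Params d H => slopeGrad ℓ x y θ' (dirSlope x θ v) :=
    (continuous_slopeGrad (H := H) (x := x) hd).comp₂ continuous_id continuous_const
  refine exists_tendsto_gradient_of_eventually (v := V) hc.continuousAt ?_
  have hev := eventually_all.2 fun k => eventually_all.2 fun i =>
    eventually_sign_add_mul (inner ℝ (inWeight θ k) (x i)) (inner ℝ (v k) (x i))
  filter_upwards [hev] with t ht
  refine differentiableAt_and_gradient_of_sign_eq hdiff hv fun k i => ?_
  rw [← ht k i, inWeight_add_smul, inner_add_left, real_inner_smul_left, hV]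

lemma finite_range_dirSlope (θ : Params d H) :
    (Set.range (dirSlope x θ)).Finite := by
  refine (Set.Finite.pi' fun _ : Fin H => Set.Finite.pi' fun _ : Fin N =>
    Set.toFinite ({1, 0, 1 / 2} : Set ℝ)).subset ?_
  rintro _ ⟨v, rfl⟩ k i
  simp only [dirSlope]
  generalize (if (inner ℝ (inWeight θ k) (x i) : ℝ) = 0 then (inner ℝ (v k) (x i) : ℝ)
    else inner ℝ (inWeight θ k) (x i)) = a
  unfold reluSlope
  split_ifs <;> simp

/-- At a kink the term is `c * slope * b` with `c = u_k ρ_i` and `b` the inner product of `q_k` with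
`x_i`. Its maximum over slopes in `[0, 1]` is reached by following the sign of `b` if `c ≥ 0` and
the opposite sign if `c < 0`; the direction `p k` does both. If `b = 0` the slope does not matter.
-/
lemma exists_maximizing_direction (hx0 : ∀ i, x i ≠ 0) {θ : Params d H} (hSQ : SQ ℓ x y θ)
    {lam : Fin H → Fin N → ℝ} (hlam : IsSlope x θ lam) (q : Params d H) :
    ∃ v : Fin H → EuclideanSpace ℝ (Fin d), (∀ k i, inner ℝ (v k) (x i) ≠ (0 : ℝ)) ∧
      inner ℝ (slopeGrad ℓ x y θ lam) q ≤
        (inner ℝ (slopeGrad ℓ x y θ (dirSlope x θ v)) q : ℝ) := by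
  choose p hp hp' using fun k => exists_inner_eq_and_inner_eq_neg (hSQ k) (inWeight q k)
  choose v hv0 hv using fun k => exists_generic_direction hx0 (p k)
  refine ⟨v, hv0, ?_⟩
  rw [inner_slopeGrad, inner_slopeGrad]
  refine Finset.sum_le_sum fun k _ => add_le_add_right (Finset.sum_le_sum fun i _ => ?_) _
  rw [mul_assoc, mul_assoc _ (dirSlope x θ v k i)]
  obtain ⟨⟨h0, h1⟩, hpos, hneg⟩ := hlam k i
  simp only [dirSlope]
  rcases lt_trichotomy (inner ℝ (inWeight θ k) (x i) : ℝ) 0 with hw | hw | hw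
  · rw [if_neg hw.ne, reluSlope_of_neg hw, hneg hw]
  · rw [if_pos hw]
    rcases le_or_gt 0 (outWeight θ k * rho ℓ x y θ i) with hc | hc
    · refine mul_le_mul_of_nonneg_left ?_ hc
      have hpi := hp k (x i) (Submodule.subset_span ⟨i, ⟨hw, hc⟩, rfl⟩)
      rcases lt_trichotomy (inner ℝ (inWeight q k) (x i) : ℝ) 0 with hq | hq | hq
      · have := hv k i (by rw [hpi]; exact hq.ne)
        rw [hpi, sign_neg hq, sign_eq_neg_one_iff] at this
        rw [reluSlope_of_neg this]
        nlinarith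
      · simp [hq]
      · have := hv k i (by rw [hpi]; exact hq.ne')
        rw [hpi, sign_pos hq, sign_eq_one_iff] at this
        rw [reluSlope_of_pos this]
        nlinarith
    · refine mul_le_mul_of_nonpos_left ?_ hc.le
      have hpi := hp' k (x i) (Submodule.subset_span ⟨i, ⟨hw, hc⟩, rfl⟩)
      rcases lt_trichotomy (inner ℝ (inWeight q k) (x i) : ℝ) 0 with hq | hq | hq
      · have := hv k i (by rw [hpi]; exact neg_ne_zero.2 hq.ne)
        rw [hpi, sign_pos (neg_pos.2 hq), sign_eq_one_iff] at this
        rw [reluSlope_of_pos this]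
        nlinarith
      · simp [hq]
      · have := hv k i (by rw [hpi]; exact neg_ne_zero.2 hq.ne')
        rw [hpi, sign_neg (neg_lt_zero.2 hq), sign_eq_neg_one_iff] at this
        rw [reluSlope_of_neg this]
        nlinarith
  · rw [if_neg hw.ne', reluSlope_of_pos hw, hpos hw]

lemma mem_convexHull_of_forall_exists_inner_le {E : Type*} [NormedAddCommGroup E]
    [InnerProductSpace ℝ E] [CompleteSpace E] {S : Set E} (hS : S.Finite) {z : E}
    (h : ∀ q : E, ∃ s ∈ S, inner ℝ z q ≤ (inner ℝ s q : ℝ)) : z ∈ convexHull ℝ S := by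
  by_contra hnot
  obtain ⟨f, u, hfS, hfz⟩ := geometric_hahn_banach_closed_point (convex_convexHull ℝ S)
    (hS.isClosed_convexHull ℝ) hnot
  have hf : ∀ g, f g = inner ℝ g ((InnerProductSpace.toDual ℝ E).symm f) := fun g => by
    rw [real_inner_comm, InnerProductSpace.toDual_symm_apply]
  obtain ⟨s, hs, hle⟩ := h ((InnerProductSpace.toDual ℝ E).symm f)
  rw [← hf, ← hf] at hle
  exact absurd (hfS s (subset_convexHull ℝ S hs)) (not_lt.2 (hfz.le.trans hle))

lemma slopeGrad_mem_clarkeSubdiff (hx0 : ∀ i, x i ≠ 0)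
    (hdiff : ∀ i, Differentiable ℝ fun t => ℓ t (y i))
    (hd : ∀ i, Continuous (deriv fun t => ℓ t (y i))) {θ : Params d H} (hSQ : SQ ℓ x y θ)
    {lam : Fin H → Fin N → ℝ} (hlam : IsSlope x θ lam) :
    slopeGrad ℓ x y θ lam ∈ clarkeSubdiff (empLoss ℓ x y) θ := by
  set S : Set (Params d H) := {g | ∃ v : Fin H → EuclideanSpace ℝ (Fin d),
    (∀ k i, inner ℝ (v k) (x i) ≠ (0 : ℝ)) ∧ slopeGrad ℓ x y θ (dirSlope x θ v) = g} with hS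
  -- Finiteness makes the convex hull closed, as the strict separation needs.
  have hfin : S.Finite := by
    refine ((finite_range_dirSlope (x := x) θ).image (slopeGrad ℓ x y θ)).subset ?_
    rintro _ ⟨v, -, rfl⟩
    exact ⟨_, ⟨v, rfl⟩, rfl⟩
  have hsub : convexHull ℝ S ⊆ clarkeSubdiff (empLoss ℓ x y) θ := by
    refine convexHull_mono ?_
    rintro _ ⟨v, hv, rfl⟩
    exact exists_tendsto_gradient_dirSlope hdiff hd θ hv
  refine hsub (mem_convexHull_of_forall_exists_inner_le hfin fun q => ?_)
  obtain ⟨v, hv, hle⟩ := exists_maximizing_direction hx0 hSQ hlam q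
  exact ⟨_, ⟨v, hv, rfl⟩, hle⟩

lemma isSlope_congr {θ θ' : Params d H} (h : SameSigns x θ θ') {lam : Fin H → Fin N → ℝ}
    (hlam : IsSlope x θ lam) : IsSlope x θ' lam := by
  refine fun k i => ⟨(hlam k i).1, fun h0 => (hlam k i).2.1 ?_, fun h0 => (hlam k i).2.2 ?_⟩
  · rwa [← sign_eq_one_iff, h k i, sign_eq_one_iff]
  · rwa [← sign_eq_neg_one_iff, h k i, sign_eq_neg_one_iff]

/-! ### Perturbation bounds -/

lemma norm_le_sum_outWeight_inWeight (θ : Params d H) :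
    ‖θ‖ ≤ ∑ k, (|outWeight θ k| + ‖inWeight θ k‖) := by
  refine (sq_le_sq₀ (norm_nonneg _) (Finset.sum_nonneg fun k _ => by positivity)).1 ?_
  rw [PiLp.norm_sq_eq_of_L2]
  refine le_trans (Finset.sum_le_sum fun k _ => ?_)
    (Finset.sum_sq_le_sq_sum_of_nonneg fun k _ => by positivity)
  rw [WithLp.prod_norm_sq_eq_of_L2]
  have : ‖(θ k).fst‖ = |outWeight θ k| := Real.norm_eq_abs _
  rw [this]
  change |outWeight θ k| ^ 2 + ‖inWeight θ k‖ ^ 2 ≤ _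
  nlinarith [mul_nonneg (abs_nonneg (outWeight θ k)) (norm_nonneg (inWeight θ k))]

lemma abs_outWeight_le_norm (θ : Params d H) (k : Fin H) : |outWeight θ k| ≤ ‖θ‖ :=
  (WithLp.norm_fst_le _ (θ k)).trans (PiLp.norm_apply_le θ k)

lemma norm_inWeight_le_norm (θ : Params d H) (k : Fin H) : ‖inWeight θ k‖ ≤ ‖θ‖ :=
  (WithLp.norm_snd_le _ (θ k)).trans (PiLp.norm_apply_le θ k)

lemma abs_relu_inner_sub_le {E : Type*} [NormedAddCommGroup E] [InnerProductSpace ℝ E]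
    {w w' z : E} {δ R : ℝ} (hw : ‖w' - w‖ ≤ δ) (hz : ‖z‖ ≤ R) :
    |max (inner ℝ w' z : ℝ) 0 - max (inner ℝ w z : ℝ) 0| ≤ δ * R := by
  refine (abs_max_sub_max_le_abs _ _ _).trans ?_
  rw [← inner_sub_left]
  exact (abs_real_inner_le_norm _ _).trans
    (mul_le_mul hw hz (norm_nonneg _) ((norm_nonneg _).trans hw))

lemma abs_relu_inner_le {E : Type*} [NormedAddCommGroup E] [InnerProductSpace ℝ E]
    {w z : E} {B R : ℝ} (hw : ‖w‖ ≤ B) (hz : ‖z‖ ≤ R) :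
    |max (inner ℝ w z : ℝ) 0| ≤ B * R := by
  simpa using abs_relu_inner_sub_le (w := 0) (w' := w) (by simpa using hw) hz

/-- The splitting `(a' - a) * b' + a * (b' - b)` needs size bounds only on the old first factor and
the new second factor. -/
lemma abs_mul_sub_mul_le {a a' b b' α β α' β' : ℝ} (ha : |a' - a| ≤ α) (hb : |b' - b| ≤ β)
    (ha' : |a| ≤ α') (hb' : |b'| ≤ β') : |a' * b' - a * b| ≤ α * β' + α' * β := by
  have h : a' * b' - a * b = (a' - a) * b' + a * (b' - b) := by ring
  rw [h]
  refine (abs_add_le _ _).trans (add_le_add ?_ ?_) <;> rw [abs_mul]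
  · exact mul_le_mul ha hb' (abs_nonneg _) ((abs_nonneg _).trans ha)
  · exact mul_le_mul ha' hb (abs_nonneg _) ((abs_nonneg _).trans ha')

lemma norm_slopeGrad_sub_le {θ θ' : Params d H} {lam : Fin H → Fin N → ℝ} {B D L R δ : ℝ}
    (hlam : IsSlope x θ lam) (hxR : ∀ i, ‖x i‖ ≤ R)
    (hu : ∀ k, |outWeight θ' k - outWeight θ k| ≤ δ) (hw : ∀ k, ‖inWeight θ' k - inWeight θ k‖ ≤ δ)
    (huB : ∀ k, |outWeight θ k| ≤ B) (hwB : ∀ k, ‖inWeight θ k‖ ≤ B)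
    (hD : ∀ i, |rho ℓ x y θ' i - rho ℓ x y θ i| ≤ D) (hL : ∀ i, |rho ℓ x y θ' i| ≤ L) :
    ‖slopeGrad ℓ x y θ' lam - slopeGrad ℓ x y θ lam‖ ≤
      H * (N * (2 * (B * D * R) + 2 * (δ * L * R))) := by
  refine (norm_le_sum_outWeight_inWeight _).trans ?_
  have key : ∀ k, |outWeight (slopeGrad ℓ x y θ' lam - slopeGrad ℓ x y θ lam) k| +
      ‖inWeight (slopeGrad ℓ x y θ' lam - slopeGrad ℓ x y θ lam) k‖ ≤
      N * (2 * (B * D * R) + 2 * (δ * L * R)) := by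
    intro k
    have ho : outWeight (slopeGrad ℓ x y θ' lam - slopeGrad ℓ x y θ lam) k =
        ∑ i, (max (inner ℝ (inWeight θ' k) (x i)) 0 * rho ℓ x y θ' i -
          max (inner ℝ (inWeight θ k) (x i)) 0 * rho ℓ x y θ i) := by
      rw [Finset.sum_sub_distrib]
      simp only [mul_comm _ (rho ℓ x y _ _)]
      rfl
    have hi : inWeight (slopeGrad ℓ x y θ' lam - slopeGrad ℓ x y θ lam) k =
        ∑ i, ((outWeight θ' k * rho ℓ x y θ' i - outWeight θ k * rho ℓ x y θ i) * lam k i) •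
          x i := by
      simp only [sub_mul, sub_smul]
      rw [Finset.sum_sub_distrib]
      rfl
    rw [ho, hi]
    refine (add_le_add (Finset.abs_sum_le_sum_abs _ _) (norm_sum_le _ _)).trans ?_
    rw [← Finset.sum_add_distrib]
    refine (Finset.sum_le_card_nsmul _ _ (2 * (B * D * R) + 2 * (δ * L * R)) fun i _ => ?_).trans_eq
      (by rw [Finset.card_univ, Fintype.card_fin, nsmul_eq_mul])
    have h1 := abs_mul_sub_mul_le (abs_relu_inner_sub_le (hw k) (hxR i)) (hD i)
      (abs_relu_inner_le (hwB k) (hxR i)) (hL i)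
    have h2 := abs_mul_sub_mul_le (hu k) (hD i) (huB k) (hL i)
    have h3 : ‖((outWeight θ' k * rho ℓ x y θ' i - outWeight θ k * rho ℓ x y θ i) * lam k i) •
        x i‖ ≤ (δ * L + B * D) * R := by
      rw [norm_smul, Real.norm_eq_abs, abs_mul]
      refine mul_le_mul ?_ (hxR i) (norm_nonneg _) ((abs_nonneg _).trans h2)
      have hl : |lam k i| ≤ 1 := abs_le.2 ⟨by linarith [(hlam k i).1.1], (hlam k i).1.2⟩
      exact (mul_le_of_le_one_right (abs_nonneg _) hl).trans h2
    linarith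
  exact (Finset.sum_le_card_nsmul _ _ _ fun k _ => key k).trans (by simp)

lemma abs_predict_sub_le {θ θ' : Params d H} {B R δ : ℝ} (hδ : 0 ≤ δ) (hx0 : ∀ i, x i ≠ 0)
    (hxR : ∀ i, ‖x i‖ ≤ R) (hsign : SameSigns x θ θ')
    (hsep : ∀ k i, inner ℝ (x i) (inWeight θ k) ≠ (0 : ℝ) →
      4 * R * δ ≤ |inner ℝ (x i) (inWeight θ k)|)
    (hu : ∀ k, |outWeight θ' k - outWeight θ k| ≤ δ) (hw : ∀ k, ‖inWeight θ' k - inWeight θ k‖ ≤ δ)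
    (huB : ∀ k, |outWeight θ k| ≤ B) (hwB : ∀ k, ‖inWeight θ k‖ ≤ B) (i : Fin N) :
    |predict θ' (x i) - predict θ (x i)| ≤ H * (9 / 4 * (B * R * δ)) := by
  unfold predict
  rw [← Finset.sum_sub_distrib]
  refine (Finset.abs_sum_le_sum_abs _ _).trans ?_
  refine (Finset.sum_le_card_nsmul _ _ (9 / 4 * (B * R * δ)) fun k _ => ?_).trans (by simp)
  have hR : 0 < R := (norm_pos_iff.2 (hx0 i)).trans_le (hxR i)
  have hB : 0 ≤ B := (abs_nonneg _).trans (huB k)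
  by_cases h0 : inner ℝ (inWeight θ k) (x i) = (0 : ℝ)
  · have h0' := hsign k i
    rw [h0, sign_zero, eq_comm, sign_eq_zero_iff] at h0'
    rw [h0, h0', max_self, mul_zero, mul_zero, sub_zero, abs_zero]
    positivity
  · have h4 : δ ≤ B / 4 := by
      have h := hsep k i (by rwa [real_inner_comm])
      have h' : |(inner ℝ (x i) (inWeight θ k) : ℝ)| ≤ R * B :=
        (abs_real_inner_le_norm _ _).trans (mul_le_mul (hxR i) (hwB k) (norm_nonneg _) hR.le)
      have : R * (4 * δ) ≤ R * B := by linarith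
      linarith [le_of_mul_le_mul_left this hR]
    have hw' : ‖inWeight θ' k‖ ≤ B + δ := by
      have := norm_add_le (inWeight θ k) (inWeight θ' k - inWeight θ k)
      rw [add_sub_cancel] at this
      linarith [hw k, hwB k]
    have h := abs_mul_sub_mul_le (hu k) (abs_relu_inner_sub_le (hw k) (hxR i)) (huB k)
      (abs_relu_inner_le hw' (hxR i))
    refine h.trans ?_
    nlinarith [mul_le_mul_of_nonneg_left h4 (mul_nonneg hδ hR.le)]

lemma mul_le_abs_inner_of_le_separationConst {θ : Params d H} {R δ : ℝ} (hx0 : ∀ i, x i ≠ 0)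
    (hxR : ∀ i, ‖x i‖ ≤ R) (hδ : (δ : EReal) ≤ separationConst x R θ) (k : Fin H) (i : Fin N)
    (h0 : inner ℝ (x i) (inWeight θ k) ≠ (0 : ℝ)) :
    4 * R * δ ≤ |inner ℝ (x i) (inWeight θ k)| := by
  have hR : 0 < R := (norm_pos_iff.2 (hx0 i)).trans_le (hxR i)
  have h : (δ : EReal) ≤ ((1 / (4 * R) * |inner ℝ (x i) (inWeight θ k)| : ℝ) : EReal) :=
    hδ.trans ((iInf_le _ i).trans ((iInf_le _ k).trans (iInf_le _ h0)))
  rw [EReal.coe_le_coe_iff, one_div_mul_eq_div, le_div_iff₀ (by positivity)] at h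
  linarith

lemma infEDist_clarkeSubdiff_le {θ θ' : Params d H} {c : ℝ} (hx0 : ∀ i, x i ≠ 0)
    (hdiff : ∀ i, Differentiable ℝ fun t => ℓ t (y i))
    (hd : ∀ i, Continuous (deriv fun t => ℓ t (y i))) (hSQ : SQ ℓ x y θ')
    (hsign : SameSigns x θ θ')
    (hc : ∀ lam, IsSlope x θ lam → ‖slopeGrad ℓ x y θ' lam - slopeGrad ℓ x y θ lam‖ ≤ c) :
    Metric.infEDist 0 (clarkeSubdiff (empLoss ℓ x y) θ') ≤
      Metric.infEDist 0 (clarkeSubdiff (empLoss ℓ x y) θ) + ENNReal.ofReal c := by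
  -- Moving `c` to the left by truncated subtraction leaves a bare infimum on the right, which can
  -- be bounded element by element.
  rw [← tsub_le_iff_right]
  refine Metric.le_infEDist.2 fun g hg => ?_
  obtain ⟨lam, hlam, rfl⟩ := clarkeSubdiff_empLoss_subset hdiff hd θ hg
  rw [tsub_le_iff_right]
  refine (Metric.infEDist_le_edist_of_mem (slopeGrad_mem_clarkeSubdiff hx0 hdiff hd hSQ
    (isSlope_congr hsign hlam))).trans ((edist_triangle _ (slopeGrad ℓ x y θ lam) _).trans ?_)
  gcongr
  rw [edist_comm, edist_dist, dist_eq_norm]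
  exact ENNReal.ofReal_le_ofReal (hc lam hlam)

end ShallowReLU

theorem theorem5 {d N H : ℕ} (ℓ : ℝ → ℝ → ℝ)
    (x : Fin N → EuclideanSpace ℝ (Fin d)) (y : Fin N → ℝ)
    (R : ℝ) (Lℓ Lℓ' : NNReal)
    (hx0 : ∀ i, x i ≠ 0) (hxR : ∀ i, ‖x i‖ ≤ R)
    (hdiff : ∀ i, Differentiable ℝ (fun t => ℓ t (y i)))
    (hlip : ∀ i, LipschitzWith Lℓ (fun t => ℓ t (y i)))
    (hlip' : ∀ i, LipschitzWith Lℓ' (deriv (fun t => ℓ t (y i))))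
    (ε : ℝ) (hε : 0 ≤ ε) (θstar : ShallowReLU.Params d H)
    (hstat : ShallowReLU.IsClarkeStationary (ShallowReLU.empLoss ℓ x y) ε θstar)
    (hSQ : ShallowReLU.SQ ℓ x y θstar)
    (δ : ℝ) (hδ0 : 0 < δ) (hδ : (δ : EReal) ≤ ShallowReLU.separationConst x R θstar)
    (θ : ShallowReLU.Params d H) (hθ : θ ∈ Metric.closedBall θstar δ) :
    (∃! θhat : ShallowReLU.Params d H, ShallowReLU.IsRndC x δ θ θhat) ∧
    ∀ θhat : ShallowReLU.Params d H, ShallowReLU.IsRndC x δ θ θhat →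
      ShallowReLU.SQ ℓ x y θhat →
      Metric.infEDist 0 (ShallowReLU.clarkeSubdiff (ShallowReLU.empLoss ℓ x y) θhat) ≤
        ENNReal.ofReal (ε + ShallowReLU.curvatureConst ‖θstar‖ R Lℓ Lℓ' N H * δ) := by
  have hsep := ShallowReLU.mul_le_abs_inner_of_le_separationConst hx0 hxR hδ
  have hθ' : ‖θ - θstar‖ ≤ δ := mem_closedBall_iff_norm.1 hθ
  have hu := fun k => (ShallowReLU.abs_outWeight_le_norm (θ - θstar) k).trans hθ'
  have hw := fun k => (ShallowReLU.norm_inWeight_le_norm (θ - θstar) k).trans hθ'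
  have hfeas := fun k => ShallowReLU.mem_rndFeasible_of_near hx0 hxR hδ0 (hsep k) (hw k)
  refine ⟨ShallowReLU.existsUnique_isRndC fun k => ⟨_, hfeas k⟩, fun θhat hrnd hSQhat => ?_⟩
  have hsign : ShallowReLU.SameSigns x θstar θhat := fun k =>
    ShallowReLU.sign_inner_eq_of_mem_rndFeasible hx0 hxR hδ0 (hsep k) (hw k) (hrnd k).2.1
  have huhat : ∀ k, |ShallowReLU.outWeight θhat k - ShallowReLU.outWeight θstar k| ≤ δ :=
    fun k => (hrnd k).1 ▸ hu k
  have hwhat : ∀ k, ‖ShallowReLU.inWeight θhat k - ShallowReLU.inWeight θstar k‖ ≤ δ :=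
    fun k => (ShallowReLU.norm_sub_le_of_isMinOn (ShallowReLU.convex_rndFeasible x δ _)
      (hrnd k).2.1 (hrnd k).2.2 (hfeas k)).trans (hw k)
  have huB := ShallowReLU.abs_outWeight_le_norm θstar
  have hwB := ShallowReLU.norm_inWeight_le_norm θstar
  have hrho : ∀ i, |ShallowReLU.rho ℓ x y θhat i - ShallowReLU.rho ℓ x y θstar i| ≤
      Lℓ' * (H * (9 / 4 * (‖θstar‖ * R * δ))) := fun i => by
    have h := (hlip' i).dist_le_mul (ShallowReLU.predict θhat (x i))
      (ShallowReLU.predict θstar (x i))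
    rw [Real.dist_eq, Real.dist_eq] at h
    exact h.trans (mul_le_mul_of_nonneg_left (ShallowReLU.abs_predict_sub_le hδ0.le hx0 hxR hsign
      hsep huhat hwhat huB hwB i) Lℓ'.2)
  have hLip : ∀ i, |ShallowReLU.rho ℓ x y θhat i| ≤ Lℓ := fun i =>
    norm_deriv_le_of_lipschitz (hlip i)
  -- The estimates yield the coefficients `9/2` and `2`, below the stated `6` and `3`. With no data
  -- `R` may be negative, but then both sides vanish.
  have hC : (H : ℝ) * (N * (2 * (‖θstar‖ * (Lℓ' * (H * (9 / 4 * (‖θstar‖ * R * δ)))) * R) +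
      2 * (δ * Lℓ * R))) ≤ ShallowReLU.curvatureConst ‖θstar‖ R Lℓ Lℓ' N H * δ := by
    rcases Nat.eq_zero_or_pos N with rfl | hN
    · simp [ShallowReLU.curvatureConst]
    · have hR : 0 ≤ R := (norm_nonneg _).trans (hxR ⟨0, hN⟩)
      have h1 : 0 ≤ (N : ℝ) * H ^ 2 * ‖θstar‖ ^ 2 * R ^ 2 * Lℓ' * δ := by positivity
      have h2 : 0 ≤ (N : ℝ) * H * R * Lℓ * δ := by positivity
      unfold ShallowReLU.curvatureConst
      nlinarith
  have hC0 : 0 ≤ ShallowReLU.curvatureConst ‖θstar‖ R Lℓ Lℓ' N H * δ := by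
    refine le_trans (norm_nonneg _) ((ShallowReLU.norm_slopeGrad_sub_le
      (ShallowReLU.isSlope_reluSlope x θstar) hxR huhat hwhat huB hwB hrho hLip).trans hC)
  rw [ENNReal.ofReal_add hε hC0]
  refine (ShallowReLU.infEDist_clarkeSubdiff_le hx0 hdiff (fun i => (hlip' i).continuous) hSQhat
    hsign fun lam hlam => ?_).trans (add_le_add_left hstat _)
  exact (ShallowReLU.norm_slopeGrad_sub_le hlam hxR huhat hwhat huB hwB hrho hLip).trans hC
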